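/- Let $k \ge 0$ and $m \ge 1$ be integers. For $\boldsymbol y, \boldsymbol z \in \mathbb{Z}_{\ge 0}^k$ put $\tilde y_i = y_1 + \cdots + y_i$ and $\tilde z_i = z_1 + \cdots + z_i$ for $1 \le i \le k$. The $m$-generalized Pitman–Stanley polytope $\operatorname{PS}_k^m(\boldsymbol y, \boldsymbol z) \subset \mathbb{R}^{km}$ is the set of all points $(x_{i,j})_{1 \le i \le k,\, 1 \le j \le m}$ such that $\tilde z_i \le x_{i,1} \le x_{i,2} \le \cdots \le x_{i,m} \le \tilde y_i$ for all $1 \le i \le k$, and $x_{i,j} \le x_{i+1,j}$ for all $1 \le i \le k-1$ and $1 \le j \le m$. Then there is a polynomial $f \in \mathbb{Q}[t_1, \ldots, t_k]$, depending only on $k$ and $m$, all of whose coefficients are nonnegative, such that for every $\boldsymbol y \in \mathbb{Z}_{\ge 0}^k$ the set $\operatorname{PS}_k^m(\boldsymbol y, \boldsymbol 0) \cap \mathbb{Z}^{km}$ is finite and $$\left|\operatorname{PS}_k^m(\boldsymbol y, \boldsymbol 0) \cap \mathbb{Z}^{km}\right| = f(y_1, \ldots, y_k).$$ -/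

import Mathlib

/-- The partial sum `y₁ + ⋯ + yᵢ` of the coordinates of `y`. -/
def partialSum {k : ℕ} (y : Fin k → ℕ) (i : Fin k) : ℕ :=
  ∑ l ∈ Finset.Iic i, y l

/-- The `m`-generalized Pitman–Stanley polytope (for `m ≥ 1`), as a set of real `k × m` arrays. -/
def pitmanStanley {k : ℕ} (m : ℕ) (y z : Fin k → ℕ) : Set (Fin k → Fin m → ℝ) :=
  {x | (∀ i j, (partialSum z i : ℝ) ≤ x i j) ∧
       (∀ i j j', j ≤ j' → x i j ≤ x i j') ∧
       (∀ i j, x i j ≤ (partialSum y i : ℝ)) ∧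
       (∀ i i' : Fin k, (i' : ℕ) = (i : ℕ) + 1 → ∀ j, x i j ≤ x i' j)}

/-- The integer lattice in the space of real `k × m` arrays. -/
def integerLattice (k m : ℕ) : Set (Fin k → Fin m → ℝ) :=
  {x | ∀ i j, ∃ n : ℤ, x i j = (n : ℝ)}

/-! Lattice points are monotone integer arrays whose `i`-th row is bounded by `y₁ + ⋯ + yᵢ`.
Subtracting 1 from every nonzero entry lowers all bounds by 1, and the support sizes of the rows
record what was removed: they form a weakly increasing sequence in `{0, …, m}`. Removing `y₁` layers
therefore contributes an entry of `Z ^ y₁`, where `Z` is the zeta matrix of these sequences under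
the componentwise order. The first row is then zero and can be dropped, so induction on `k` writes
the count as a sum of products of entries of powers of `Z` (`card_boundedArrays_add`,
`card_boundedArrays_tail`).

It remains to see that the entries of `Z ^ n` are polynomials in `n` with nonnegative coefficients.
They are Kreweras determinants (`zetaMatrix_pow`). Writing `P(n) = Z ^ n`, the law `P(s + n) = P(s)
P(n)` gives `P' = P'(0) P`, so nonnegativity of the linear coefficients propagates to all others
(`coeff_nonneg_of_eval_add`). The linear coefficients are read off from the determinant
(`det_krewerasMatrix_coeff`). -/

/-! ### Rising factorial polynomials -/

open Polynomial in
/-- The polynomial `∏_{k < r} (X + e + k) / r!`, i.e. the coefficient of `t ^ r` in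
`(1 - t) ^ (-(X + e))`; it is zero for negative `r`. -/
noncomputable def risingPoly (r e : ℤ) : ℚ[X] :=
  if 0 ≤ r then
    C (1 / (r.toNat.factorial : ℚ)) * ∏ k ∈ Finset.range r.toNat, (X + C ((e : ℚ) + k))
  else 0

theorem risingPoly_of_neg {r : ℤ} (e : ℤ) (hr : r < 0) : risingPoly r e = 0 := by
  simp [risingPoly, not_le.2 hr]

theorem risingPoly_natCast (n : ℕ) (e : ℤ) : risingPoly n e =
    Polynomial.C (1 / (n.factorial : ℚ)) *
      ∏ k ∈ Finset.range n, (Polynomial.X + Polynomial.C ((e : ℚ) + k)) := by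
  simp [risingPoly]

theorem eval_risingPoly_natCast (n : ℕ) (e : ℤ) (q : ℚ) : (risingPoly n e).eval q =
    (∏ k ∈ Finset.range n, (q + (e + k))) / n.factorial := by
  rw [risingPoly_natCast, Polynomial.eval_mul, Polynomial.eval_prod]
  simp [div_eq_inv_mul]

theorem risingPoly_zero (e : ℤ) : risingPoly 0 e = 1 := by
  simp [risingPoly]

theorem eval_add_one_risingPoly (r e : ℤ) (q : ℚ) :
    (risingPoly r e).eval (q + 1) = (risingPoly r (e + 1)).eval q := by
  rcases lt_or_ge r 0 with hr | hr
  · simp [risingPoly_of_neg _ hr]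
  · lift r to ℕ using hr
    rw [eval_risingPoly_natCast, eval_risingPoly_natCast]
    congr 1
    refine Finset.prod_congr rfl fun k _ => ?_
    push_cast; ring

/-- Compare coefficients of `t ^ r` in `(1 - t) · (1 - t) ^ (-(q + 1 + e)) = (1 - t) ^ (-(q + e))`.
-/
theorem eval_risingPoly_sub (r e : ℤ) (q : ℚ) :
    (risingPoly r e).eval (q + 1) - (risingPoly (r - 1) e).eval (q + 1) =
      (risingPoly r e).eval q := by
  rcases lt_or_ge r 0 with hr | hr
  · simp [risingPoly_of_neg _ hr, risingPoly_of_neg e (show r - 1 < 0 by omega)]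
  · lift r to ℕ using hr
    rcases r with _ | n
    · simp [risingPoly_zero, risingPoly_of_neg e (show (-1 : ℤ) < 0 by omega)]
    · have h1 : (((n + 1 : ℕ) : ℤ) - 1) = (n : ℤ) := by push_cast; ring
      rw [h1, eval_risingPoly_natCast, eval_risingPoly_natCast, eval_risingPoly_natCast,
        Finset.prod_range_succ, Finset.prod_range_succ' (fun k : ℕ => q + ((e : ℚ) + k))]
      have h2 : ∏ k ∈ Finset.range n, (q + ((e : ℚ) + ((k + 1 : ℕ) : ℚ))) =
          ∏ k ∈ Finset.range n, (q + 1 + ((e : ℚ) + k)) :=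
        Finset.prod_congr rfl fun k _ => by push_cast; ring
      rw [h2, Nat.factorial_succ]
      have h3 : (n.factorial : ℚ) ≠ 0 := by positivity
      have h4 : (n : ℚ) + 1 ≠ 0 := by positivity
      push_cast
      field_simp
      ring

theorem coeff_zero_risingPoly {r e : ℤ} (he : e ≤ 0) (hr : -e < r) :
    (risingPoly r e).coeff 0 = 0 := by
  lift r to ℕ using by omega
  rw [Polynomial.coeff_zero_eq_eval_zero, eval_risingPoly_natCast,
    Finset.prod_eq_zero (i := (-e).toNat), zero_div]
  · simp only [Finset.mem_range]; omega
  · have : (((-e).toNat : ℤ) : ℚ) = -e := by rw [Int.toNat_of_nonneg (by omega)]; push_cast; ring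
    rw [← Int.cast_natCast, this]; ring

theorem coeff_zero_risingPoly_one {r : ℤ} (hr : 0 ≤ r) : (risingPoly r 1).coeff 0 = 1 := by
  lift r to ℕ using hr
  rw [Polynomial.coeff_zero_eq_eval_zero, eval_risingPoly_natCast, div_eq_one_iff_eq (by positivity),
    ← Finset.prod_range_add_one_eq_factorial]
  push_cast
  exact Finset.prod_congr rfl fun k _ => by ring

/-- The factor with `k = p` is `X`; at `X = 0` the `p` factors before it are negative and those
after it positive. -/
theorem neg_one_pow_mul_coeff_one_risingPoly {r : ℤ} (p : ℕ) (hr : p < r) :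
    0 ≤ (-1) ^ p * (risingPoly r (-p)).coeff 1 := by
  obtain ⟨t, rfl⟩ : ∃ t : ℕ, r = ((p + 1 + t : ℕ) : ℤ) :=
    ⟨(r - p - 1).toNat, by push_cast; omega⟩
  rw [risingPoly_natCast, Polynomial.coeff_C_mul, Finset.prod_range_add, Finset.prod_range_succ]
  have h0 : (Polynomial.X + Polynomial.C (((-(p : ℤ) : ℤ) : ℚ) + (p : ℚ))) = Polynomial.X := by
    simp
  rw [h0, mul_right_comm, Polynomial.coeff_mul_X, Polynomial.coeff_zero_eq_eval_zero,
    Polynomial.eval_mul, Polynomial.eval_prod, Polynomial.eval_prod, mul_left_comm, ← mul_assoc ((-1) ^ p)]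
  refine mul_nonneg (by positivity) (mul_nonneg ?_ (Finset.prod_nonneg fun k _ => ?_))
  · have h1 : ((-1 : ℚ)) ^ p = ∏ _k ∈ Finset.range p, (-1 : ℚ) := by simp
    rw [h1, ← Finset.prod_mul_distrib]
    refine Finset.prod_nonneg fun k hk => ?_
    have : (k : ℚ) ≤ p := by exact_mod_cast (Finset.mem_range.1 hk).le
    simp only [Polynomial.eval_add, Polynomial.eval_X, Polynomial.eval_C]
    push_cast
    linarith
  · simp only [Polynomial.eval_add, Polynomial.eval_X, Polynomial.eval_C]
    push_cast
    have : (0 : ℚ) ≤ k := by positivity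
    linarith

/-! ### Constant and linear coefficients of the Kreweras determinant -/

/-- The matrix whose determinant counts the multichains between two monotone sequences. -/
noncomputable def krewerasMatrix {l : ℕ} (a b : Fin l → ℤ) : Matrix (Fin l) (Fin l) (Polynomial ℚ) :=
  Matrix.of fun j i => risingPoly (b i - a j + i - j) ((j : ℤ) - i)

/-- The lower left block has negative first index throughout, so it vanishes. Entries depend on
positions only through `i - j`, so the diagonal blocks are again Kreweras matrices. -/
theorem det_krewerasMatrix_add {s t : ℕ} {a b : Fin (s + t) → ℤ}
    (h : ∀ (i : Fin s) (j : Fin t), b (Fin.castAdd t i) ≤ a (Fin.natAdd s j)) :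
    (krewerasMatrix a b).det =
      (krewerasMatrix (a ∘ Fin.castAdd t) (b ∘ Fin.castAdd t)).det *
        (krewerasMatrix (a ∘ Fin.natAdd s) (b ∘ Fin.natAdd s)).det := by
  rw [← Matrix.det_submatrix_equiv_self finSumFinEquiv,
    ← Matrix.fromBlocks_toBlocks ((krewerasMatrix a b).submatrix finSumFinEquiv finSumFinEquiv)]
  have h21 : ((krewerasMatrix a b).submatrix finSumFinEquiv finSumFinEquiv).toBlocks₂₁ = 0 := by
    ext1 j i
    have := h i j
    simp only [Matrix.toBlocks₂₁, krewerasMatrix, Matrix.submatrix_apply, Matrix.of_apply,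
      finSumFinEquiv_apply_left, finSumFinEquiv_apply_right, Matrix.zero_apply]
    apply risingPoly_of_neg
    simp only [Fin.val_castAdd, Fin.val_natAdd]
    push_cast
    have := i.2
    omega
  rw [h21, Matrix.det_fromBlocks_zero₂₁]
  congr 2
  · ext1 j i
    simp [Matrix.toBlocks₂₂, krewerasMatrix]
    congr 1
    all_goals ring

theorem coeff_zero_det {n : Type*} [DecidableEq n] [Fintype n] (M : Matrix n n (Polynomial ℚ)) :
    M.det.coeff 0 = (M.map fun p => p.coeff 0).det :=
  RingHom.map_det Polynomial.constantCoeff M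

/-- The determinant of the Kreweras matrix for a connected skew shape. -/
theorem det_krewerasMatrix_of_connected {l : ℕ} {a b : Fin (l + 1) → ℤ} (ha : Monotone a)
    (hab : ∀ i, a i < b i) (h : ∀ i : Fin l, a i.succ < b i.castSucc) :
    (krewerasMatrix a b).det.coeff 0 = 0 ∧ 0 ≤ (krewerasMatrix a b).det.coeff 1 := by
  -- On and above the diagonal every entry is divisible by `X`, in particular the whole first row
  -- and last column.
  have hz : ∀ j i : Fin (l + 1), j ≤ i → (krewerasMatrix a b j i).coeff 0 = 0 := by
    intro j i hij
    have h1 := ha hij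
    have h2 := hab i
    have h3 : (j : ℕ) ≤ i := hij
    exact coeff_zero_risingPoly (by omega) (by omega)
  have h0 : (krewerasMatrix a b).det.coeff 0 = 0 := by
    rw [coeff_zero_det]
    exact Matrix.det_eq_zero_of_row_eq_zero 0 fun i => hz 0 i (Fin.zero_le i)
  refine ⟨h0, ?_⟩
  -- Only the top right corner contributes to the linear term: every other minor keeps the last
  -- column. The corner's minor is lower triangular with unit diagonal at `X = 0`, and the cofactor
  -- sign cancels the sign of the corner's linear coefficient.
  rw [Matrix.det_succ_row_zero, Polynomial.finsetSum_coeff, Finset.sum_eq_single (Fin.last l)]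
  · have hd : ((krewerasMatrix a b).submatrix Fin.succ (Fin.last l).succAbove).det.coeff 0 = 1 := by
      rw [coeff_zero_det, Matrix.det_of_isLowerTriangular]
      · refine Finset.prod_eq_one fun i _ => ?_
        have := h i
        simp only [Matrix.map_apply, Matrix.submatrix_apply, Fin.succAbove_last, krewerasMatrix,
          Matrix.of_apply, Fin.val_succ, Fin.val_castSucc]
        rw [show ((i + 1 : ℕ) : ℤ) - (i : ℕ) = 1 by push_cast; ring]
        exact coeff_zero_risingPoly_one (by push_cast; omega)
      · intro i j hij
        simp only [Matrix.map_apply, Matrix.submatrix_apply, Fin.succAbove_last]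
        refine hz _ _ ?_
        have : (i : ℕ) < j := hij
        rw [Fin.le_def]; simp; omega
    have hc : (-1 : Polynomial ℚ) ^ ((Fin.last l : Fin (l + 1)) : ℕ) = Polynomial.C ((-1) ^ l) := by
      simp
    rw [hc, mul_assoc, Polynomial.coeff_C_mul, Polynomial.mul_coeff_one, hz 0 _ (Fin.zero_le _),
      zero_mul, zero_add, hd, mul_one]
    have := neg_one_pow_mul_coeff_one_risingPoly (r := b (Fin.last l) - a 0 + l) l (by
      have := hab (Fin.last l)
      have := ha (Fin.zero_le (Fin.last l))
      omega)
    simpa [krewerasMatrix] using this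
  · intro i _ hi
    have hd : ((krewerasMatrix a b).submatrix Fin.succ i.succAbove).det.coeff 0 = 0 := by
      rw [coeff_zero_det]
      obtain ⟨c, hc⟩ := Fin.exists_succAbove_eq (Ne.symm hi)
      refine Matrix.det_eq_zero_of_column_eq_zero c fun j => ?_
      simp only [Matrix.map_apply, Matrix.submatrix_apply, hc]
      exact hz _ _ (Fin.le_last _)
    have hc : (-1 : Polynomial ℚ) ^ (i : ℕ) = Polynomial.C ((-1) ^ (i : ℕ)) := by simp
    rw [hc, mul_assoc, Polynomial.coeff_C_mul, Polynomial.mul_coeff_one, hz 0 _ (Fin.zero_le _),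
      hd, zero_mul, mul_zero, zero_add, mul_zero]
  · simp

theorem det_krewerasMatrix_coeff (l : ℕ) : ∀ a b : Fin l → ℤ, Monotone a → Monotone b →
    (krewerasMatrix a b).det.coeff 0 = (if a = b then 1 else 0) ∧
      0 ≤ (krewerasMatrix a b).det.coeff 1 := by
  induction l using Nat.strong_induction_on with
  | _ l ih =>
  intro a b ha hb
  -- If the determinant factors, its linear coefficient is nonnegative because both constant terms
  -- are 0 or 1. If no split exists, the shape is connected or of size one.
  by_cases hs : ∃ (s t : ℕ) (hl : l = (s + 1) + (t + 1)),
      b ⟨s, by omega⟩ ≤ a ⟨s + 1, by omega⟩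
  · obtain ⟨s, t, rfl, hst⟩ := hs
    rw [det_krewerasMatrix_add (s := s + 1) (t := t + 1)]
    · have h1 := ih (s + 1) (by omega) (a ∘ Fin.castAdd (t + 1)) (b ∘ Fin.castAdd (t + 1))
        (ha.comp (Fin.strictMono_castAdd _).monotone) (hb.comp (Fin.strictMono_castAdd _).monotone)
      have h2 := ih (t + 1) (by omega) (a ∘ Fin.natAdd (s + 1)) (b ∘ Fin.natAdd (s + 1))
        (ha.comp (Fin.strictMono_natAdd _).monotone) (hb.comp (Fin.strictMono_natAdd _).monotone)
      have hab : a = b ↔ a ∘ Fin.castAdd (t + 1) = b ∘ Fin.castAdd (t + 1) ∧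
          a ∘ Fin.natAdd (s + 1) = b ∘ Fin.natAdd (s + 1) := by
        constructor
        · rintro rfl; exact ⟨rfl, rfl⟩
        · rintro ⟨e1, e2⟩
          funext i
          refine Fin.addCases (fun i => congrFun e1 i) (fun i => congrFun e2 i) i
      refine ⟨?_, ?_⟩
      · rw [Polynomial.mul_coeff_zero, h1.1, h2.1]
        simp only [hab]
        split_ifs <;> simp_all
      · rw [Polynomial.mul_coeff_one, h1.1, h2.1]
        have h1' := h1.2
        have h2' := h2.2
        split_ifs <;> simp <;> linarith
    · intro i j
      refine (hb ?_).trans (hst.trans (ha ?_))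
      · rw [Fin.le_def]; simp; omega
      · rw [Fin.le_def]; simp
  · rcases l with _ | l
    · simp [Subsingleton.elim a b, Polynomial.coeff_one]
    · by_cases h00 : l = 0 ∧ b 0 ≤ a 0
      · obtain ⟨rfl, h00⟩ := h00
        have hab : a = b ↔ a 0 = b 0 :=
          ⟨fun h => h ▸ rfl, fun h => funext fun i => by rwa [Fin.fin_one_eq_zero i]⟩
        simp only [hab]
        rw [Matrix.det_fin_one]
        simp only [krewerasMatrix, Matrix.of_apply]
        rcases h00.lt_or_eq with h | h
        · rw [risingPoly_of_neg _ (by simpa using h)]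
          simp [h.ne']
        · simp [h, risingPoly_zero, Polynomial.coeff_one]
      · have h : ∀ i : Fin l, a i.succ < b i.castSucc := by
          intro i
          by_contra! hi
          exact hs ⟨i, l - i - 1, by omega, hi⟩
        have hab : ∀ i, a i < b i := by
          intro i
          rcases Nat.eq_zero_or_pos l with rfl | hl
          · rw [Fin.fin_one_eq_zero i]
            by_contra! hi
            exact h00 ⟨rfl, hi⟩
          · induction i using Fin.lastCases with
            | cast i => exact (ha (Fin.castSucc_lt_succ (i := i)).le).trans_lt (h i)
            | last =>
              obtain ⟨l, rfl⟩ : ∃ l', l = l' + 1 := ⟨l - 1, by omega⟩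
              have := h (Fin.last l)
              rw [Fin.succ_last] at this
              exact this.trans_le (hb (Fin.le_last _))
        have hc := det_krewerasMatrix_of_connected ha hab h
        refine ⟨?_, hc.2⟩
        rw [hc.1, if_neg]
        rintro rfl
        exact lt_irrefl _ (hab 0)
-- Powers of the zeta matrix as determinants
/-- The weakly increasing sequences of length `l` with entries in `{0, …, m}`. -/
noncomputable def monoSet (l m : ℕ) : Finset (Fin l → ℕ) :=
  open scoped Classical in
  (Fintype.piFinset fun _ : Fin l => Finset.range (m + 1)).filter Monotone

theorem mem_monoSet {l m : ℕ} {a : Fin l → ℕ} : a ∈ monoSet l m ↔ Monotone a ∧ ∀ i, a i ≤ m := by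
  simp [monoSet, and_comm]

theorem tail_mem_monoSet {l m : ℕ} {a : Fin (l + 1) → ℕ} (ha : a ∈ monoSet (l + 1) m) :
    Fin.tail a ∈ monoSet l m := by
  rw [mem_monoSet] at *
  exact ⟨ha.1.comp (Fin.strictMono_succ).monotone, fun i => ha.2 _⟩

/-- The sum telescopes in the first argument; the upper boundary term dies because that argument is
zero or repeats another one. -/
theorem map_vecCons_sum_eq {V : Type*} [AddCommGroup V] [Module ℚ V] {l : ℕ}
    (f : V [⋀^Fin (l + 1)]→ₗ[ℚ] ℚ) (u U : ℕ → V) (w : Fin l → V) {s t : ℕ} (hst : s ≤ t)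
    (h : ∀ c, U c - U (c + 1) = u c) (ht : U t = 0 ∨ ∃ i, U t = w i) :
    ∑ c ∈ Finset.Ico s t, f (Matrix.vecCons (u c) w) = f (Matrix.vecCons (U s) w) := by
  have h0 : f (Matrix.vecCons (U t) w) = 0 := by
    rcases ht with ht | ⟨i, ht⟩
    · exact f.map_coord_zero 0 (by simpa using ht)
    · exact f.map_eq_zero_of_eq _ (i := 0) (j := i.succ) (by simpa using ht) (Fin.succ_ne_zero i).symm
  simp only [← AlternatingMap.curryLeft_apply_apply] at *
  have h1 : ∀ c, f.curryLeft (u c) w = f.curryLeft (U c) w - f.curryLeft (U (c + 1)) w := by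
    intro c
    rw [← h, map_sub, AlternatingMap.sub_apply]
  have h2 := Finset.sum_Ico_sub (fun c => f.curryLeft (U c) w) hst
  rw [Finset.sum_congr rfl fun c _ => h1 c, ← neg_inj, ← Finset.sum_neg_distrib]
  simp only [neg_sub]
  rw [h2, h0, zero_sub]

open scoped Classical in
/-- Summation of an alternating map over monotone sequences, by telescoping. -/
theorem sum_monoSet_alternatingMap {V : Type*} [AddCommGroup V] [Module ℚ V] (m : ℕ) :
    ∀ (l : ℕ) (f : V [⋀^Fin l]→ₗ[ℚ] ℚ) (u U : ℕ → ℕ → V) (a : Fin l → ℕ), a ∈ monoSet l m →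
      (∀ j c, U j c - U j (c + 1) = u j c) → (∀ j c, U j (c + 1) = u (j + 1) c) →
      (∀ j, j + 1 = l → U j (m + 1) = 0) →
      ∑ c ∈ monoSet l m with a ≤ c, f (fun j => u j (c j)) = f (fun j => U j (a j)) := by
  intro l
  induction l with
  | zero =>
    intro f u U a ha _ _ _
    have : (monoSet 0 m).filter (a ≤ ·) = {a} := by
      ext c
      simp [Subsingleton.elim c a, ha]
    rw [this, Finset.sum_singleton]
    congr 1
    exact Subsingleton.elim _ _
  | succ l ih =>
    intro f u U a ha h1 h2 h3
    have htail := tail_mem_monoSet ha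
    -- The largest admissible first entry: the next entry of the sequence, or `m` if there is none.
    let top : (Fin l → ℕ) → ℕ := fun c => if h : 0 < l then c ⟨0, h⟩ else m
    have key : ∀ c : Fin l → ℕ, Fin.tail a ≤ c →
        ∑ x ∈ Finset.Ico (a 0) (top c + 1),
          f (Matrix.vecCons (u 0 x) (fun j : Fin l => u (j + 1) (c j))) =
        (f.curryLeft (U 0 (a 0))) (fun j : Fin l => u (j + 1) (c j)) := by
      intro c hc
      rw [AlternatingMap.curryLeft_apply_apply]
      refine map_vecCons_sum_eq f (u 0) (U 0) _ ?_ (h1 0) ?_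
      · simp only [top]
        split_ifs with h
        · have := (mem_monoSet.1 ha).1 (Fin.zero_le (Fin.succ ⟨0, h⟩))
          have := hc ⟨0, h⟩
          simp only [Fin.tail] at this
          omega
        · have := (mem_monoSet.1 ha).2 0
          omega
      · simp only [top]
        split_ifs with h
        · exact Or.inr ⟨⟨0, h⟩, h2 _ _⟩
        · exact Or.inl (h3 0 (by omega))
    have hf : f (fun j => U j (a j)) =
        (f.curryLeft (U 0 (a 0))) (fun j : Fin l => U (j + 1) (Fin.tail a j)) := by
      rw [AlternatingMap.curryLeft_apply_apply]
      congr 1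
      funext j
      refine Fin.cases ?_ (fun j => ?_) j <;> simp [Fin.tail]
    rw [hf, ← ih (f.curryLeft (U 0 (a 0))) (fun j => u (j + 1)) (fun j => U (j + 1)) (Fin.tail a)
      htail (fun j => h1 _) (fun j => h2 _) (fun j hj => h3 _ (by omega)),
      ← Finset.sum_congr rfl fun c hc => key c (Finset.mem_filter.1 hc).2, Finset.sum_sigma']
    refine Finset.sum_nbij' (fun c => ⟨Fin.tail c, c 0⟩) (fun x => Fin.cons x.2 x.1) ?_ ?_ ?_ ?_ ?_
    · intro c hc
      rw [Finset.mem_filter] at hc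
      simp only [Finset.mem_sigma, Finset.mem_filter, Finset.mem_Ico, top]
      refine ⟨⟨tail_mem_monoSet hc.1, fun i => hc.2 _⟩, hc.2 0, Nat.lt_succ_of_le ?_⟩
      split_ifs
      · exact (mem_monoSet.1 hc.1).1 (Fin.zero_le _)
      · exact (mem_monoSet.1 hc.1).2 0
    · rintro ⟨c, x⟩ hc
      simp only [Finset.mem_sigma, Finset.mem_filter, Finset.mem_Ico, top] at hc
      obtain ⟨⟨hc1, hc2⟩, hx1, hx2⟩ := hc
      rw [mem_monoSet] at hc1
      have hx : ∀ i, x ≤ c i := by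
        intro i
        rw [dif_pos (i.pos)] at hx2
        exact (Nat.lt_succ_iff.1 hx2).trans (hc1.1 (Nat.zero_le _))
      have hxm : x ≤ m := by
        split_ifs at hx2 with h
        · exact (hx ⟨0, h⟩).trans (hc1.2 _)
        · omega
      rw [Finset.mem_filter, mem_monoSet]
      refine ⟨⟨?_, ?_⟩, ?_⟩
      · intro i j
        refine Fin.cases ?_ (fun i => ?_) i <;> refine Fin.cases ?_ (fun j => ?_) j
        · simp
        · intro _; simpa using hx j
        · intro h; exact absurd h (by simp)
        · intro h; simpa using hc1.1 (Fin.succ_le_succ_iff.1 h)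
      · intro i
        refine Fin.cases ?_ (fun i => ?_) i
        · simpa using hxm
        · simpa using hc1.2 i
      · intro i
        refine Fin.cases ?_ (fun i => ?_) i
        · simpa using hx1
        · rw [Fin.cons_succ]
          exact hc2 i
    · intro c _
      simp
    · rintro ⟨c, x⟩ _
      simp
    · intro c _
      congr 1
      funext j
      refine Fin.cases ?_ (fun j => ?_) j <;> simp [Fin.tail]

open scoped Classical in
/-- The zeta matrix of the componentwise order on `monoSet l m`. -/
noncomputable def zetaMatrix (l m : ℕ) : Matrix (monoSet l m) (monoSet l m) ℚ :=
  Matrix.of fun a b => if a.1 ≤ b.1 then 1 else 0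

/-- The polynomial counting the multichains from `a` to `b`. -/
noncomputable def zetaPoly {l m : ℕ} (a b : monoSet l m) : Polynomial ℚ :=
  (krewerasMatrix (fun i => (a.1 i : ℤ)) (fun i => (b.1 i : ℤ))).det

theorem eval_zetaPoly {l m : ℕ} (a b : monoSet l m) (q : ℚ) : (zetaPoly a b).eval q =
    Matrix.detRowAlternating (fun j i : Fin l =>
      (risingPoly ((b.1 i : ℤ) - a.1 j + i - j) ((j : ℤ) - i)).eval q) :=
  RingHom.map_det (Polynomial.evalRingHom q) _

theorem zetaPoly_coeff {l m : ℕ} (a b : monoSet l m) :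
    (zetaPoly a b).coeff 0 = (if a = b then 1 else 0) ∧ 0 ≤ (zetaPoly a b).coeff 1 := by
  have h := det_krewerasMatrix_coeff l (fun i => (a.1 i : ℤ)) (fun i => (b.1 i : ℤ))
    (fun i j hij => Int.ofNat_le.2 ((mem_monoSet.1 a.2).1 hij))
    (fun i j hij => Int.ofNat_le.2 ((mem_monoSet.1 b.2).1 hij))
  have hab : a = b ↔ (fun i => (a.1 i : ℤ)) = (fun i => (b.1 i : ℤ)) := by
    rw [Subtype.ext_iff, funext_iff, funext_iff]
    simp
  simp only [hab]
  exact h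

open scoped Classical in
theorem eval_zetaPoly_add_one {l m : ℕ} (a b : monoSet l m) (q : ℚ) :
    (zetaPoly a b).eval (q + 1) = ∑ c : monoSet l m, zetaMatrix l m a c * (zetaPoly c b).eval q := by
  simp only [zetaMatrix, Matrix.of_apply, ite_mul, one_mul, zero_mul, eval_zetaPoly]
  rw [Finset.sum_coe_sort (monoSet l m) (fun c => if a.1 ≤ c then
    Matrix.detRowAlternating (fun j i : Fin l =>
      (risingPoly ((b.1 i : ℤ) - c j + i - j) ((j : ℤ) - i)).eval q) else 0),
    ← Finset.sum_filter]
  refine (sum_monoSet_alternatingMap m l Matrix.detRowAlternating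
    (fun j c i => (risingPoly ((b.1 i : ℤ) - c + i - j) ((j : ℤ) - i)).eval q)
    (fun j c i => (risingPoly ((b.1 i : ℤ) - c + i - j) ((j : ℤ) - i)).eval (q + 1))
    a.1 a.2 ?_ ?_ ?_).symm
  · intro j c
    funext i
    rw [Pi.sub_apply, ← eval_risingPoly_sub _ _ q]
    congr 3
    push_cast
    ring
  · intro j c
    funext i
    rw [eval_add_one_risingPoly]
    congr 2 <;> (push_cast; ring)
  · intro j hj
    funext i
    have := (mem_monoSet.1 b.2).2 i
    have := i.2
    rw [risingPoly_of_neg _ (by push_cast; omega)]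
    simp

theorem zetaMatrix_pow {l m : ℕ} (n : ℕ) (a b : monoSet l m) :
    (zetaMatrix l m ^ n) a b = (zetaPoly a b).eval (n : ℚ) := by
  induction n generalizing a with
  | zero =>
    rw [pow_zero, Matrix.one_apply, Nat.cast_zero, ← Polynomial.coeff_zero_eq_eval_zero,
      (zetaPoly_coeff a b).1]
  | succ n ih =>
    rw [pow_succ', Matrix.mul_apply, Nat.cast_succ, eval_zetaPoly_add_one]
    simp only [ih]

/-! ### Nonnegativity of all coefficients -/

/-- If a matrix of polynomials is multiplicative in its argument, then its coefficients are
nonnegative as soon as the constant and linear ones are. -/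
theorem coeff_nonneg_of_eval_add {T : Type*} [Fintype T] (p : T → T → Polynomial ℚ)
    (hadd : ∀ a b (s n : ℕ), (p a b).eval ((s : ℚ) + n) =
      ∑ c, (p a c).eval (s : ℚ) * (p c b).eval (n : ℚ))
    (h0 : ∀ a b, 0 ≤ (p a b).coeff 0) (h1 : ∀ a b, 0 ≤ (p a b).coeff 1) (i : ℕ) :
    ∀ a b, 0 ≤ (p a b).coeff i := by
  have hinf : (Set.range ((↑) : ℕ → ℚ)).Infinite := Set.infinite_range_of_injective Nat.cast_injective
  have hcomp : ∀ a b (n : ℕ), (p a b).comp (Polynomial.X + Polynomial.C (n : ℚ)) =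
      ∑ c, p a c * Polynomial.C ((p c b).eval (n : ℚ)) := by
    intro a b n
    refine Polynomial.eq_of_infinite_eval_eq _ _ (hinf.mono ?_)
    rintro _ ⟨s, rfl⟩
    simp [Polynomial.eval_finsetSum, hadd]
  -- Differentiate the addition law in `s` at `s = 0`.
  have hder : ∀ a b, Polynomial.derivative (p a b) =
      ∑ c, Polynomial.C ((p a c).coeff 1) * p c b := by
    intro a b
    refine Polynomial.eq_of_infinite_eval_eq _ _ (hinf.mono ?_)
    rintro _ ⟨n, rfl⟩
    have h := congrArg (fun q => (Polynomial.derivative q).eval 0) (hcomp a b n)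
    have hc : ∀ q : Polynomial ℚ, q.derivative.eval 0 = q.coeff 1 := by
      intro q
      simp [← Polynomial.coeff_zero_eq_eval_zero, Polynomial.coeff_derivative]
    simp only [Polynomial.derivative_comp, Polynomial.derivative_sum] at h
    simpa [Polynomial.eval_finsetSum, hc] using h
  induction i with
  | zero => exact h0
  | succ i ih =>
    intro a b
    have h := congrArg (fun q => q.coeff i) (hder a b)
    simp only [Polynomial.coeff_derivative, Polynomial.finsetSum_coeff, Polynomial.coeff_C_mul] at h
    have h2 : 0 ≤ (p a b).coeff (i + 1) * ((i : ℚ) + 1) :=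
      h ▸ Finset.sum_nonneg fun c _ => mul_nonneg (h1 a c) (ih c b)
    exact nonneg_of_mul_nonneg_left h2 (by positivity)

theorem zetaPoly_coeff_nonneg {l m : ℕ} (a b : monoSet l m) (i : ℕ) :
    0 ≤ (zetaPoly a b).coeff i := by
  refine coeff_nonneg_of_eval_add zetaPoly (fun a b s n => ?_) (fun a b => ?_)
    (fun a b => (zetaPoly_coeff a b).2) i a b
  · simp only [← zetaMatrix_pow, ← Nat.cast_add, pow_add, Matrix.mul_apply]
  · rw [(zetaPoly_coeff a b).1]
    split_ifs <;> norm_num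
-- Removing layers from monotone arrays
/-- The number of nonzero entries. -/
def supportCard {m : ℕ} (g : Fin m → ℕ) : ℕ :=
  (Finset.univ.filter fun j => g j ≠ 0).card

theorem supportCard_le {m : ℕ} (g : Fin m → ℕ) : supportCard g ≤ m :=
  (Finset.card_le_univ _).trans (by simp)

theorem supportCard_mono {m : ℕ} {g g' : Fin m → ℕ} (h : g ≤ g') :
    supportCard g ≤ supportCard g' := by
  refine Finset.card_le_card fun j hj => ?_
  simp only [Finset.mem_filter, Finset.mem_univ, true_and] at *
  have : g j ≤ g' j := h j
  omega

/-- The support of a monotone row is a final segment, hence determined by its size. -/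
theorem ne_zero_iff_le_add_supportCard {m : ℕ} {g : Fin m → ℕ} (hg : Monotone g) (j : Fin m) :
    g j ≠ 0 ↔ m ≤ j + supportCard g := by
  constructor
  · intro h
    have : (Finset.Ici j).card ≤ supportCard g := Finset.card_le_card fun j' hj' => by
      have := hg (Finset.mem_Ici.1 hj')
      simp only [Finset.mem_filter, Finset.mem_univ, true_and]
      omega
    rw [Fin.card_Ici] at this
    omega
  · intro h h0
    have : supportCard g ≤ (Finset.Ioi j).card := Finset.card_le_card fun j' hj' => by
      simp only [Finset.mem_filter, Finset.mem_univ, true_and] at hj'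
      rw [Finset.mem_Ioi]
      by_contra! hle
      have := hg hle
      omega
    rw [Fin.card_Ioi] at this
    have := j.2
    omega

theorem le_of_forall_le_add_imp {m c d : ℕ} (hc : c ≤ m)
    (h : ∀ j : Fin m, m ≤ j + c → m ≤ j + d) : c ≤ d := by
  by_contra! hlt
  have := h ⟨m - c, by omega⟩ (by simp only; omega)
  simp only at this
  omega

/-- The monotone arrays with row bounds `B` whose `i`-th row has at most its last `a i` entries
nonzero. -/
noncomputable def boundedArrays {k : ℕ} (m : ℕ) (B a : Fin k → ℕ) : Finset (Fin k → Fin m → ℕ) :=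
  open scoped Classical in
  (Fintype.piFinset fun i => Fintype.piFinset fun _ : Fin m => Finset.range (B i + 1)).filter
    fun x => (∀ i, Monotone (x i)) ∧ Monotone x ∧ ∀ i j, x i j ≠ 0 → m ≤ j + a i

theorem mem_boundedArrays {k m : ℕ} {B a : Fin k → ℕ} {x : Fin k → Fin m → ℕ} :
    x ∈ boundedArrays m B a ↔ (∀ i j, x i j ≤ B i) ∧
      (∀ i, Monotone (x i)) ∧ Monotone x ∧ ∀ i j, x i j ≠ 0 → m ≤ j + a i := by
  simp [boundedArrays]

open scoped Classical in
theorem card_boundedArrays_add_one {k m : ℕ} (B a : Fin k → ℕ) :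
    (boundedArrays m (fun i => B i + 1) a).card =
      ∑ b ∈ monoSet k m with b ≤ a, (boundedArrays m B b).card := by
  rw [← Finset.card_sigma]
  -- Lower all nonzero entries by 1 and remember the support sizes; the inverse adds 1 to the last
  -- `b i` entries of row `i`.
  refine Finset.card_nbij' (fun x => ⟨fun i => supportCard (x i), fun i j => x i j - 1⟩)
    (fun p i j => p.2 i j + if m ≤ j + p.1 i then 1 else 0) ?_ ?_ ?_ ?_
  · intro x hx
    obtain ⟨h1, h2, h3, h4⟩ := mem_boundedArrays.1 hx
    simp only [Finset.coe_sigma, Set.mem_sigma_iff, Finset.mem_coe, Finset.mem_filter,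
      mem_monoSet, mem_boundedArrays]
    refine ⟨⟨⟨fun i i' hi => supportCard_mono (h3 hi), fun i => supportCard_le _⟩, fun i => ?_⟩,
      fun i j => ?_, fun i j j' hj => ?_, fun i i' hi j => ?_, fun i j hx0 => ?_⟩
    · exact le_of_forall_le_add_imp (supportCard_le _) fun j hj =>
        h4 i j ((ne_zero_iff_le_add_supportCard (h2 i) j).2 hj)
    · have := h1 i j
      omega
    · exact Nat.sub_le_sub_right (h2 i hj) 1
    · exact Nat.sub_le_sub_right (h3 hi j) 1
    · exact (ne_zero_iff_le_add_supportCard (h2 i) j).1 (by omega)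
  · rintro ⟨b, x⟩ hx
    simp only [Finset.coe_sigma, Set.mem_sigma_iff, Finset.mem_coe, Finset.mem_filter,
      mem_monoSet, mem_boundedArrays] at hx
    obtain ⟨⟨⟨hb1, hb2⟩, hb3⟩, h1, h2, h3, h4⟩ := hx
    rw [Finset.mem_coe, mem_boundedArrays]
    refine ⟨fun i j => ?_, fun i j j' hj => ?_, fun i i' hi j => ?_, fun i j hx0 => ?_⟩
    · have := h1 i j
      dsimp only
      split_ifs <;> omega
    · have := h2 i hj
      have : (j : ℕ) ≤ j' := hj
      dsimp only
      split_ifs <;> omega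
    · have : x i j ≤ x i' j := h3 hi j
      have : b i ≤ b i' := hb1 hi
      dsimp only
      split_ifs <;> omega
    · have := h4 i j
      have := hb3 i
      dsimp only at hx0 this
      split_ifs at hx0 <;> omega
  · intro x hx
    obtain ⟨h1, h2, h3, h4⟩ := mem_boundedArrays.1 hx
    funext i j
    have := ne_zero_iff_le_add_supportCard (h2 i) j
    dsimp only
    split_ifs <;> omega
  · rintro ⟨b, x⟩ hx
    simp only [Finset.coe_sigma, Set.mem_sigma_iff, Finset.mem_coe, Finset.mem_filter,
      mem_monoSet, mem_boundedArrays] at hx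
    obtain ⟨⟨⟨hb1, hb2⟩, hb3⟩, h1, h2, h3, h4⟩ := hx
    refine Sigma.ext ?_ (heq_of_eq ?_)
    · funext i
      have hm : Monotone fun j : Fin m => x i j + if m ≤ j + b i then 1 else 0 := fun j j' hj => by
        have := h2 i hj
        have : (j : ℕ) ≤ j' := hj
        dsimp only
        split_ifs <;> omega
      have key := ne_zero_iff_le_add_supportCard hm
      refine le_antisymm (le_of_forall_le_add_imp (supportCard_le _) fun j hj => ?_)
        (le_of_forall_le_add_imp (hb2 i) fun j hj => (key j).1 ?_)
      · have h5 := (key j).2 hj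
        have := h4 i j
        split_ifs at h5 <;> omega
      · rw [if_pos hj]
        omega
    · funext i j
      have := h4 i j
      dsimp only
      split_ifs <;> omega

theorem card_boundedArrays_tail {k m : ℕ} (B a : Fin (k + 1) → ℕ) (hB : B 0 = 0) :
    (boundedArrays m B a).card = (boundedArrays m (Fin.tail B) (Fin.tail a)).card := by
  refine Finset.card_nbij' (fun x => Fin.tail x) (fun x => Fin.cons (fun _ => 0) x) ?_ ?_ ?_ ?_
  · intro x hx
    obtain ⟨h1, h2, h3, h4⟩ := mem_boundedArrays.1 hx
    exact mem_boundedArrays.2 ⟨fun i => h1 _, fun i => h2 _,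
      h3.comp Fin.strictMono_succ.monotone, fun i => h4 _⟩
  · intro x hx
    obtain ⟨h1, h2, h3, h4⟩ := mem_boundedArrays.1 hx
    refine mem_boundedArrays.2 ⟨fun i => ?_, fun i => ?_, fun i i' => ?_, fun i => ?_⟩
    · refine Fin.cases ?_ (fun i => ?_) i
      · simp
      · dsimp only
        rw [Fin.cons_succ]
        exact h1 i
    · refine Fin.cases ?_ (fun i => ?_) i
      · simpa using monotone_const
      · simpa using h2 i
    · refine Fin.cases ?_ (fun i => ?_) i
      · intro _ j
        simp
      · refine Fin.cases ?_ (fun i' => ?_) i'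
        · intro h; exact absurd h (by simp)
        · intro h; simpa using h3 (Fin.succ_le_succ_iff.1 h)
    · refine Fin.cases ?_ (fun i => ?_) i
      · simp
      · dsimp only
        rw [Fin.cons_succ]
        exact h4 i
  · intro x hx
    obtain ⟨h1, h2, h3, h4⟩ := mem_boundedArrays.1 hx
    have h0 : (fun _ => 0) = x 0 := by
      funext j
      have := h1 0 j
      omega
    dsimp only
    rw [h0, Fin.cons_self_tail]
  · intro x _
    simp

theorem card_boundedArrays_add {k m : ℕ} (B : Fin k → ℕ) (n : ℕ) (a : monoSet k m) :
    ((boundedArrays m (fun i => B i + n) a).card : ℚ) =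
      ∑ b : monoSet k m, (zetaMatrix k m ^ n) b a * (boundedArrays m B b).card := by
  classical
  induction n generalizing a with
  | zero => simp [Matrix.one_apply]
  | succ n ih =>
    have h := card_boundedArrays_add_one (m := m) (fun i => B i + n) a
    simp only [add_assoc] at h
    rw [h, Finset.sum_filter, ← Finset.sum_coe_sort (monoSet k m)]
    push_cast
    simp only [ih, pow_succ, Matrix.mul_apply, Finset.sum_mul]
    rw [Finset.sum_comm]
    refine Finset.sum_congr rfl fun c _ => ?_
    have hz : zetaMatrix k m c a = if c.1 ≤ a.1 then 1 else 0 := by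
      simp only [zetaMatrix, Matrix.of_apply]
    rw [hz]
    split_ifs <;> simp

/-! ### Polynomials with nonnegative coefficients and the induction on `k` -/

/-- The functions of `k` natural numbers given by a rational polynomial with nonnegative
coefficients. -/
def IsNonnegPolynomial {k : ℕ} (F : (Fin k → ℕ) → ℚ) : Prop :=
  ∃ f : MvPolynomial (Fin k) ℚ, (∀ d, 0 ≤ MvPolynomial.coeff d f) ∧
    ∀ y, F y = MvPolynomial.eval (fun i => (y i : ℚ)) f

namespace IsNonnegPolynomial

theorem monomial {k : ℕ} (d : Fin k →₀ ℕ) {c : ℚ} (hc : 0 ≤ c) :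
    IsNonnegPolynomial fun y => MvPolynomial.eval (fun i => (y i : ℚ)) (MvPolynomial.monomial d c) := by
  classical
  refine ⟨_, fun e => ?_, fun y => rfl⟩
  rw [MvPolynomial.coeff_monomial]
  split_ifs
  · exact hc
  · exact le_rfl

theorem sum {k : ℕ} {ι : Type*} (s : Finset ι) {F : ι → (Fin k → ℕ) → ℚ}
    (h : ∀ i ∈ s, IsNonnegPolynomial (F i)) : IsNonnegPolynomial fun y => ∑ i ∈ s, F i y := by
  choose! f hf hF using h
  refine ⟨∑ i ∈ s, f i, fun d => ?_, fun y => ?_⟩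
  · rw [MvPolynomial.coeff_sum]
    exact Finset.sum_nonneg fun i hi => hf i hi d
  · rw [map_sum]
    exact Finset.sum_congr rfl fun i hi => hF i hi y

theorem mul {k : ℕ} {F G : (Fin k → ℕ) → ℚ} (hF : IsNonnegPolynomial F)
    (hG : IsNonnegPolynomial G) : IsNonnegPolynomial fun y => F y * G y := by
  classical
  obtain ⟨f, hf, hF⟩ := hF
  obtain ⟨g, hg, hG⟩ := hG
  refine ⟨f * g, fun d => ?_, fun y => ?_⟩
  · rw [MvPolynomial.coeff_mul]
    exact Finset.sum_nonneg fun x _ => mul_nonneg (hf _) (hg _)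
  · simp only [map_mul, hF, hG]

theorem eval_apply {k : ℕ} (i : Fin k) {p : Polynomial ℚ} (hp : ∀ n, 0 ≤ p.coeff n) :
    IsNonnegPolynomial fun y : Fin k → ℕ => p.eval (y i : ℚ) := by
  have h := sum (Finset.range (p.natDegree + 1)) fun n _ =>
    monomial (Finsupp.single i n) (hp n)
  simpa [Polynomial.eval_eq_sum_range, MvPolynomial.eval_monomial] using h

theorem tail {k : ℕ} {F : (Fin k → ℕ) → ℚ} (hF : IsNonnegPolynomial F) :
    IsNonnegPolynomial fun y : Fin (k + 1) → ℕ => F (Fin.tail y) := by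
  obtain ⟨f, hf, hF⟩ := hF
  refine ⟨MvPolynomial.rename Fin.succ f, fun d => ?_, fun y => ?_⟩
  · by_cases hd : MvPolynomial.coeff d (MvPolynomial.rename Fin.succ f) = 0
    · exact hd.ge
    · obtain ⟨e, rfl, _⟩ := MvPolynomial.coeff_rename_ne_zero _ _ _ hd
      rw [MvPolynomial.coeff_rename_mapDomain _ (Fin.succ_injective k)]
      exact hf e
  · simp only [hF]
    rw [MvPolynomial.eval_rename]
    rfl

end IsNonnegPolynomial

theorem partialSum_zero {k : ℕ} (y : Fin (k + 1) → ℕ) : partialSum y 0 = y 0 := by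
  have : (Finset.Iic (0 : Fin (k + 1))) = {0} := by
    ext i
    simp
  rw [partialSum, this, Finset.sum_singleton]

theorem partialSum_succ {k : ℕ} (y : Fin (k + 1) → ℕ) (i : Fin k) :
    partialSum y i.succ = partialSum (Fin.tail y) i + y 0 := by
  have h : ∀ (n : ℕ) (z : Fin n → ℕ) (i : Fin n), partialSum z i = ∑ l, if l ≤ i then z l else 0 := by
    intro n z i
    rw [partialSum, ← Finset.sum_filter]
    congr 1
    ext l
    simp
  rw [h, h, Fin.sum_univ_succ, add_comm]
  simp [Fin.tail]

/-- The support bound `a` must vary in the induction: removing `y 0` layers replaces it by every `b`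
from which a multichain reaches `a`. -/
theorem isNonnegPolynomial_card_boundedArrays (k m : ℕ) : ∀ a ∈ monoSet k m,
    IsNonnegPolynomial fun y => ((boundedArrays m (partialSum y) a).card : ℚ) := by
  induction k with
  | zero =>
    intro a _
    have h := IsNonnegPolynomial.monomial (0 : Fin 0 →₀ ℕ)
      (Nat.cast_nonneg (α := ℚ) (boundedArrays m (partialSum 0) a).card)
    convert h using 2 with y
    rw [Subsingleton.elim y 0]
    simp
  | succ k ih =>
    intro a ha
    have key : ∀ y : Fin (k + 1) → ℕ, ((boundedArrays m (partialSum y) a).card : ℚ) =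
        ∑ b : monoSet (k + 1) m, (zetaPoly b ⟨a, ha⟩).eval (y 0 : ℚ) *
          (boundedArrays m (partialSum (Fin.tail y)) (Fin.tail b.1)).card := by
      intro y
      have hy : partialSum y =
          fun i => (Fin.cons 0 (partialSum (Fin.tail y)) : Fin (k + 1) → ℕ) i + y 0 := by
        funext i
        refine Fin.cases ?_ (fun i => ?_) i
        · simp [partialSum_zero]
        · simp [partialSum_succ]
      rw [hy, card_boundedArrays_add _ _ ⟨a, ha⟩]
      refine Finset.sum_congr rfl fun b _ => ?_
      rw [zetaMatrix_pow, card_boundedArrays_tail _ _ (by simp), Fin.tail_cons]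
    simp only [key]
    exact IsNonnegPolynomial.sum _ fun b _ =>
      (IsNonnegPolynomial.eval_apply 0 (zetaPoly_coeff_nonneg b _)).mul
        (ih _ (tail_mem_monoSet b.2)).tail

/-! ### Lattice points as arrays -/

theorem pitmanStanley_inter_integerLattice {k : ℕ} (m : ℕ) (y : Fin k → ℕ) :
    pitmanStanley m y 0 ∩ integerLattice k m =
      (fun (x : Fin k → Fin m → ℕ) i j => (x i j : ℝ)) ''
        (boundedArrays m (partialSum y) fun _ => m) := by
  ext x
  constructor
  · rintro ⟨⟨h0, h1, h2, h3⟩, hx⟩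
    choose n hn using hx
    have hn0 : ∀ i j, 0 ≤ n i j := by
      intro i j
      have := h0 i j
      rw [hn] at this
      simpa [partialSum] using this
    refine ⟨fun i j => (n i j).toNat, ?_, ?_⟩
    · simp only [hn, Int.cast_le] at h1 h3
      rw [Finset.mem_coe, mem_boundedArrays]
      refine ⟨fun i j => ?_, fun i j j' hj => Int.toNat_le_toNat (h1 i j j' hj), ?_,
        fun i j _ => Nat.le_add_left _ _⟩
      · have := h2 i j
        rw [hn] at this
        have : n i j ≤ (partialSum y i : ℤ) := by exact_mod_cast this
        omega
      · rcases k with _ | k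
        · intro i
          exact i.elim0
        · rw [Fin.monotone_iff_le_succ]
          exact fun i j => Int.toNat_le_toNat (h3 i.castSucc i.succ (by simp) j)
    · funext i j
      have : (((n i j).toNat : ℤ) : ℝ) = n i j := by rw [Int.toNat_of_nonneg (hn0 i j)]
      rw [hn, ← this, Int.cast_natCast]
  · rintro ⟨x, hx, rfl⟩
    obtain ⟨h1, h2, h3, -⟩ := mem_boundedArrays.1 hx
    refine ⟨⟨fun i j => ?_, fun i j j' hj => ?_, fun i j => ?_, fun i i' hi j => ?_⟩, fun i j => ?_⟩
    · simp [partialSum]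
    · exact Nat.cast_le.2 (h2 i hj)
    · exact Nat.cast_le.2 (h1 i j)
    · exact Nat.cast_le.2 (h3 (show i ≤ i' by rw [Fin.le_def]; omega) j)
    · exact ⟨x i j, by simp⟩

theorem mainTheorem4 (k m : ℕ) (hm : 1 ≤ m) :
    ∃ f : MvPolynomial (Fin k) ℚ,
      (∀ d : Fin k →₀ ℕ, 0 ≤ MvPolynomial.coeff d f) ∧
      ∀ y : Fin k → ℕ,
        (pitmanStanley m y 0 ∩ integerLattice k m).Finite ∧
        ((pitmanStanley m y 0 ∩ integerLattice k m).ncard : ℚ) =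
          MvPolynomial.eval (fun i => (y i : ℚ)) f := by
  -- The constant sequence `m` imposes no restriction on supports.
  obtain ⟨f, hf, h⟩ := isNonnegPolynomial_card_boundedArrays k m (fun _ => m)
    (mem_monoSet.2 ⟨monotone_const, fun _ => le_rfl⟩)
  refine ⟨f, hf, fun y => ?_⟩
  rw [pitmanStanley_inter_integerLattice]
  refine ⟨(Finset.finite_toSet _).image _, ?_⟩
  rw [Set.ncard_image_of_injective, Set.ncard_coe_finset, ← h y]
  intro x x' hxx
  funext i j
  exact Nat.cast_injective (congrFun (congrFun hxx i) j)
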